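/- **Definitions.** A map $F$ is cyclically monotone on $M\subseteq\mathbb{R}^d$ if $\sum_{i}\langle F(x_i),x_i\rangle\ge\sum_i\langle F(x_{\pi(i)}),x_i\rangle$ for all finite families $x_1,\dots,x_n\in M$ and all permutations $\pi$. Let $\mu,\nu$ be absolutely continuous probability measures on $\mathbb{R}^d$, with $N=\operatorname{supp}\nu$ convex and compact. A map $F:\mathbb{R}^d\to\mathbb{R}^d$ is a *Brenier distribution function* (BDF) of $\mu$ with respect to $\nu$ if there are a cyclically monotone map $\tilde F:\operatorname{supp}\mu\to N$ with $\tilde F\#\mu=\nu$ and a sequence $(x_i,y_i)_{i\ge 0}$ of points of the graph of $\tilde F$ over $\operatorname{supp}\mu$, dense in this graph, such that, with $$\psi(y)=\sup_{I\subset\mathbb{N}\text{ finite}}\ \max_{\pi\in\mathrm{Perm}(I\cup\{0\})}\Bigl(\langle y,x_{\pi(0)}\rangle-\Bigl(\langle y_0,x_{\pi(0)}\rangle-\sum_{i\in I\cup\{0\}}\langle y_i-y_{\pi(i)},x_{\pi(i)}\rangle\Bigr)\Bigr),$$ $\psi_N=\psi$ on $N$ and $\psi_N=\infty$ off $N$,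 and with $\psi_N^*$ the Legendre transform of $\psi_N$, one has $F(x)=\nabla\psi_N^*(x)$ for Lebesgue almost every $x$ and $F(x)\in\partial\psi_N^*(x)$ for every $x\in\mathbb{R}^d$. **Statement.** Let $c(t)=\max(1,|t|)\sqrt{\max(1,|t|)^2-1}$, let $\mu$ be the measure on $\mathbb{R}^2$ with Lebesgue density $\frac1\pi\frac{x_2^4-x_1^2}{x_2^6}$ where $c(x_2)\le|x_1|<x_2^2$ and $0$ elsewhere, let $\nu$ be the uniform distribution on the closed unit disc $B$ of $\mathbb{R}^2$, and let $$F_\mu(x)=\begin{cases}0&x_1=x_2=0,\\ \frac1{|x_1|}(x_1,0)&x_1\ne0,\ x_2^2\le|x_1|,\\ \frac1{x_2^3}(x_1x_2,\ x_2^4-x_1^2)&c(x_2)\le|x_1|<x_2^2,\\ \frac{1}{\|x\|}x&|x_1|<c(x_2).\end{cases}$$ Then: 1. $\mu$ is an absolutely continuous probability measure, and $F_\mu$ maps $\mathbb{R}^2$ into $B$. 2. $F_\mu$ is cyclically monotone on $\mathbb{R}^2$, $F_\mu\#\mu=\nu$, and $F_\mu$ is a BDF of $\mu$ with respect to $\nu$.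 So is every map obtained from $F_\mu$ by replacing its value at $0$ by a point of the segment between $(1,0)$ and $-(1,0)$. 3. No map that agrees with $F_\mu$ Lebesgue almost everywhere is continuous at $0$. Hence BDFs of absolutely continuous measures need not be continuous. This remains so under a finite second moment: there are an absolutely continuous probability measure $\mu'$ on $\mathbb{R}^2$ with $\int\|x\|^2\,d\mu'<\infty$ and a BDF of $\mu'$ with respect to $\nu$ that is not continuous. -/

import Mathlib

open MeasureTheory Set

noncomputable section

/-- The Euclidean space of dimension `d`. -/
abbrev Euc (d : ℕ) : Type := EuclideanSpace ℝ (Fin d)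

/-- `F` is cyclically monotone on the set `M`. -/
def CyclicallyMonotoneOn {d : ℕ} (F : Euc d → Euc d) (M : Set (Euc d)) : Prop :=
  ∀ (n : ℕ) (x : Fin n → Euc d), (∀ i, x i ∈ M) → ∀ π : Equiv.Perm (Fin n),
    ∑ i, inner ℝ (F (x (π i))) (x i) ≤ ∑ i, inner ℝ (F (x i)) (x i)

/-- The graph of `F` over the set `M`. -/
def graphOver {d : ℕ} (F : Euc d → Euc d) (M : Set (Euc d)) : Set (Euc d × Euc d) :=
  (fun x => (x, F x)) '' M

/-- Rockafellar's potential `ψ` attached to a sequence `p i = (x i, y i)` of points of a graph,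
based at the point `p 0 = (x 0, y 0)`. The supremum runs over the finite index sets `I` and the
permutations `π` of `I ∪ {0}`. -/
def rockafellarPotential {d : ℕ} (p : ℕ → Euc d × Euc d) (y : Euc d) : EReal :=
  ⨆ (I : Finset ℕ) (π : Equiv.Perm {i // i ∈ insert 0 I}),
    ((inner ℝ y (p (π ⟨0, Finset.mem_insert_self 0 I⟩)).1
      - (inner ℝ (p 0).2 (p (π ⟨0, Finset.mem_insert_self 0 I⟩)).1
        - ∑ i : {i // i ∈ insert 0 I},
            inner ℝ ((p i).2 - (p (π i)).2) (p (π i)).1) : ℝ) : EReal)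

open Classical in
/-- The convex indicator function: `0` on `N` and `∞` elsewhere. -/
def convexIndicator {d : ℕ} (N : Set (Euc d)) (y : Euc d) : EReal :=
  if y ∈ N then 0 else ⊤

/-- The Legendre transform of an extended real valued function. -/
def legendreTransform {d : ℕ} (f : Euc d → EReal) (x : Euc d) : EReal :=
  ⨆ y : Euc d, ((inner ℝ x y : ℝ) : EReal) - f y

/-- The subdifferential of `f` at `x`. -/
def subdifferentialAt {d : ℕ} (f : Euc d → EReal) (x : Euc d) : Set (Euc d) :=
  {y | ∀ z, f x + ((inner ℝ y (z - x) : ℝ) : EReal) ≤ f z}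

/-- `F`, defined on the whole space, is a Lebesgue representation with respect to `μ`, `ν` of the
map `T` defined on the support of `μ`: for some sequence dense in the graph of `T`, with
Rockafellar potential `ψ`, and with `ψ_N` equal to `ψ` plus the convex indicator of
`N = supp ν`, the map `F` is the gradient of the Legendre transform of `ψ_N` Lebesgue almost
everywhere, and a selection of its subdifferential everywhere. -/
def IsLebesgueRepresentation {d : ℕ} (μ ν : Measure (Euc d)) (T F : Euc d → Euc d) : Prop :=
  ∃ p : ℕ → Euc d × Euc d,
    (∀ i, p i ∈ graphOver T μ.support) ∧
    graphOver T μ.support ⊆ closure (range p) ∧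
    (∀ᵐ x, HasGradientAt
      (fun z => (legendreTransform
        (fun y => rockafellarPotential p y + convexIndicator ν.support y) z).toReal) (F x) x) ∧
    ∀ x, F x ∈ subdifferentialAt
      (legendreTransform
        (fun y => rockafellarPotential p y + convexIndicator ν.support y)) x

/-- `F` is a Brenier distribution function of the absolutely continuous probability measure `μ`
with respect to the absolutely continuous probability measure `ν`, whose support is convex and
compact: it is a Lebesgue representation of a cyclically monotone map `T : supp μ → supp ν` that
pushes `μ` forward to `ν`. -/
structure IsBDF {d : ℕ} (μ ν : Measure (Euc d)) (F : Euc d → Euc d) : Prop where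
  isProbabilityMeasure_left : IsProbabilityMeasure μ
  absolutelyContinuous_left : μ ≪ volume
  isProbabilityMeasure_right : IsProbabilityMeasure ν
  absolutelyContinuous_right : ν ≪ volume
  isCompact_support : IsCompact ν.support
  convex_support : Convex ℝ ν.support
  exists_map : ∃ T : Euc d → Euc d,
    MapsTo T μ.support ν.support ∧ CyclicallyMonotoneOn T μ.support ∧
    AEMeasurable T μ ∧ μ.map T = ν ∧ IsLebesgueRepresentation μ ν T F

/-- The uniform distribution on the closed unit ball. -/
def uniformUnitBall (d : ℕ) : Measure (Euc d) :=
  ProbabilityTheory.cond volume (Metric.closedBall (0 : Euc d) 1)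

/-- The function `c(t) = max(1,|t|) * sqrt(max(1,|t|)^2 - 1)`. -/
def boundaryCurve (t : ℝ) : ℝ :=
  max 1 |t| * √((max 1 |t|) ^ 2 - 1)

/-- The density of the measure of the counterexample. -/
def exampleDensity (x : Euc 2) : ℝ :=
  if boundaryCurve (x 1) ≤ |x 0| ∧ |x 0| < (x 1) ^ 2 then
    1 / Real.pi * (((x 1) ^ 4 - (x 0) ^ 2) / (x 1) ^ 6)
  else 0

/-- The measure of the counterexample. -/
def exampleMeasure : Measure (Euc 2) :=
  volume.withDensity (fun x => ENNReal.ofReal (exampleDensity x))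

/-- The map of the counterexample. The last branch is the region `|x 0| < c (x 1)`. -/
def exampleMap (x : Euc 2) : Euc 2 :=
  if x 0 = 0 ∧ x 1 = 0 then 0
  else if x 0 ≠ 0 ∧ (x 1) ^ 2 ≤ |x 0| then (1 / |x 0|) • !₂[x 0, 0]
  else if boundaryCurve (x 1) ≤ |x 0| ∧ |x 0| < (x 1) ^ 2 then
    (1 / (x 1) ^ 3) • !₂[x 0 * x 1, (x 1) ^ 4 - (x 0) ^ 2]
  else (1 / ‖x‖) • x

end

/-! ### Maximizer selections in a Legendre transform -/

noncomputable section

/-! Everything is driven by the potential `ψ y = y₁² / (2 (a - y₀²))` on the closed unit disc. It is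
convex, being the supremum over `b` of `b y₁ - (a - y₀²) b² / 2`, and it vanishes on the horizontal
diameter. The map of the example picks, for each `x`, a maximizer of `⟪x, y⟫ - ψ y` over the disc
with `a = 1` (`isLegendreSelection_exampleMap`). Such a selection is cyclically monotone and
consists of subgradients of the Legendre transform, which is 1-Lipschitz, so by Rademacher the
selection is its gradient almost everywhere. The gradient of `ψ` inverts the selection off the
diameter, and the Jacobian of the inverse map is `π` times the density of the example; hence the
measure is the image of the uniform distribution under `∇ψ`. For the BDF property, Rockafellar's
potential of a dense sequence in the graph must be `ψ` itself on the disc. The sequence is chosen to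
start at `(0, 0)` and to repeat each point infinitely often. Then both functions have `∇ψ` as a
subgradient selection, so they differ by a constant (`sub_eq_sub_of_common_subgradient`), which is
zero at the origin (`rockafellarPotential_eq`). Continuity fails since `ψ = 0` on the diameter:
linear functionals `(±t, 0)` with `t > 0` are maximized at `(±1, 0)`, however small `t` is. For `a =
1` the same values are taken on the open sets `x₁² < ±x₀`, which excludes all versions; for `a = 2`
the gradient of `ψ` is bounded on the disc, so the second moment is finite. -/

/-- `F` selects, for every `x`, a maximizer of `⟪x, y⟫ - ψ y` over `y ∈ N`. -/
def IsLegendreSelection {d : ℕ} (N : Set (Euc d)) (ψ : Euc d → ℝ) (F : Euc d → Euc d) : Prop :=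
  ∀ x, F x ∈ N ∧ ∀ y ∈ N, inner ℝ x y - ψ y ≤ inner ℝ x (F x) - ψ (F x)

/-- The value of the maximum in the definition of a Legendre selection. -/
def legendreValue {d : ℕ} (ψ : Euc d → ℝ) (F : Euc d → Euc d) (x : Euc d) : ℝ :=
  inner ℝ x (F x) - ψ (F x)

namespace IsLegendreSelection

variable {d : ℕ} {N : Set (Euc d)} {ψ : Euc d → ℝ} {F : Euc d → Euc d}

/-- Summing the maximality inequalities suffices, because a permutation does not change the sum of
the `ψ` terms. -/
theorem cyclicallyMonotoneOn (h : IsLegendreSelection N ψ F) (M : Set (Euc d)) :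
    CyclicallyMonotoneOn F M := by
  intro n x _ π
  have h1 : ∑ i, (inner ℝ (x i) (F (x (π i))) - ψ (F (x (π i))))
      ≤ ∑ i, (inner ℝ (x i) (F (x i)) - ψ (F (x i))) :=
    Finset.sum_le_sum fun i _ => (h (x i)).2 _ (h _).1
  rw [Finset.sum_sub_distrib, Finset.sum_sub_distrib,
    Equiv.sum_comp π (fun i => ψ (F (x i)))] at h1
  simp only [real_inner_comm] at h1 ⊢
  linarith

theorem legendreValue_add_inner_le (h : IsLegendreSelection N ψ F) (x z : Euc d) :
    legendreValue ψ F x + inner ℝ (F x) (z - x) ≤ legendreValue ψ F z := by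
  have := (h z).2 (F x) (h x).1
  simp only [legendreValue, inner_sub_right]
  rw [real_inner_comm z (F x), real_inner_comm x (F x)]
  linarith

theorem update (h : IsLegendreSelection N ψ F) {x v : Euc d} (hv : v ∈ N)
    (hmax : ∀ y ∈ N, inner ℝ x y - ψ y ≤ inner ℝ x v - ψ v) :
    IsLegendreSelection N ψ (Function.update F x v) := by
  intro z
  by_cases hz : z = x
  · subst hz
    rw [Function.update_self]
    exact ⟨hv, hmax⟩
  · rw [Function.update_of_ne hz]
    exact h z

theorem lipschitzWith_legendreValue (h : IsLegendreSelection N ψ F)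
    (hN : N ⊆ Metric.closedBall 0 1) : LipschitzWith 1 (legendreValue ψ F) := by
  refine LipschitzWith.of_le_add_mul 1 fun x y => ?_
  have h1 := h.legendreValue_add_inner_le x y
  have h2 : |inner ℝ (F x) (y - x)| ≤ ‖F x‖ * ‖y - x‖ := abs_real_inner_le_norm _ _
  have h3 : ‖F x‖ ≤ 1 := by simpa using hN (h x).1
  have h4 : ‖F x‖ * ‖y - x‖ ≤ 1 * ‖y - x‖ := by gcongr
  rw [dist_comm, dist_eq_norm]
  have := neg_abs_le (inner ℝ (F x) (y - x))
  simp only [NNReal.coe_one]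
  linarith

theorem hasGradientAt_of_differentiableAt (h : IsLegendreSelection N ψ F) {x : Euc d}
    (hx : DifferentiableAt ℝ (legendreValue ψ F) x) :
    HasGradientAt (legendreValue ψ F) (F x) x := by
  -- The affine function with slope `F x` supports the value from below at `x`, so the difference is
  -- minimal there.
  have hmin : IsLocalMin (fun z => legendreValue ψ F z - innerSL ℝ (F x) z) x := by
    refine Filter.Eventually.of_forall fun z => ?_
    have := h.legendreValue_add_inner_le x z
    simp only [innerSL_apply_apply, inner_sub_right] at this ⊢
    linarith
  have hd := hx.hasFDerivAt.sub (innerSL ℝ (F x)).hasFDerivAt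
  have h0 := hmin.hasFDerivAt_eq_zero hd
  rw [sub_eq_zero] at h0
  rw [hasGradientAt_iff_hasFDerivAt]
  have : (InnerProductSpace.toDual ℝ (Euc d)) (F x) = innerSL ℝ (F x) := by
    ext z; simp
  rw [this, ← h0]
  exact hx.hasFDerivAt

theorem ae_hasGradientAt (h : IsLegendreSelection N ψ F) (hN : N ⊆ Metric.closedBall 0 1) :
    ∀ᵐ x, HasGradientAt (legendreValue ψ F) (F x) x := by
  filter_upwards [(h.lipschitzWith_legendreValue hN).ae_differentiableAt (μ := volume)] with x hx
  exact h.hasGradientAt_of_differentiableAt hx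

/-- A selection may be arbitrary on a null set, but it agrees almost everywhere with the gradient,
and `fderiv` is always measurable. -/
theorem aemeasurable (h : IsLegendreSelection N ψ F) (hN : N ⊆ Metric.closedBall 0 1) :
    AEMeasurable F volume := by
  refine ⟨fun x => (InnerProductSpace.toDual ℝ (Euc d)).symm (fderiv ℝ (legendreValue ψ F) x),
    (InnerProductSpace.toDual ℝ (Euc d)).symm.continuous.measurable.comp (measurable_fderiv ℝ _),
    ?_⟩
  filter_upwards [h.ae_hasGradientAt hN] with x hx
  exact hx.gradient.symm

end IsLegendreSelection

/-! ### Subgradients determine a function up to a constant -/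

/-- Two functions with a common selection of subgradients on a convex set differ by a constant. -/
theorem sub_eq_sub_of_common_subgradient {E : Type*} [NormedAddCommGroup E]
    [InnerProductSpace ℝ E] {S : Set E} (hS : Convex ℝ S) {f g : E → ℝ} {X : E → E}
    (hf : ∀ y ∈ S, ∀ z ∈ S, f y + inner ℝ (z - y) (X y) ≤ f z)
    (hg : ∀ y ∈ S, ∀ z ∈ S, g y + inner ℝ (z - y) (X y) ≤ g z)
    {a b : E} (ha : a ∈ S) (hb : b ∈ S) : f a - g a = f b - g b := by
  -- Cutting the segment into `n + 1` equal pieces bounds the change of `f - g` by `L / (n + 1)`; no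
  -- differentiability is needed.
  set L : ℝ := inner ℝ (b - a) (X b - X a) with hL
  have key : ∀ n : ℕ, |(f b - g b) - (f a - g a)| ≤ L / (n + 1) := by
    intro n
    set γ : ℕ → E := fun k => a + ((k : ℝ) / (n + 1)) • (b - a) with hγ
    have hpos : (0 : ℝ) < n + 1 := by positivity
    have hmem : ∀ k, k ≤ n + 1 → γ k ∈ S := by
      intro k hk
      refine hS.add_smul_sub_mem ha hb ⟨by positivity, ?_⟩
      rw [div_le_one hpos]; exact_mod_cast hk
    have hstep : ∀ k, γ (k + 1) - γ k = ((1 : ℝ) / (n + 1)) • (b - a) := by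
      intro k
      simp only [hγ, add_sub_add_left_eq_sub, ← sub_smul]
      congr 1; push_cast; field_simp; ring
    have h0 : γ 0 = a := by simp [hγ]
    have h1 : γ (n + 1) = b := by
      simp only [hγ]; push_cast; rw [div_self hpos.ne']; simp
    -- The subgradient inequalities in both directions put the increments of `f` and of `g` between
    -- the same two numbers, whose gaps telescope.
    have hb' : ∀ k ∈ Finset.range (n + 1),
        |(f (γ (k + 1)) - g (γ (k + 1))) - (f (γ k) - g (γ k))|
          ≤ inner ℝ (b - a) (X (γ (k + 1))) / (n + 1) - inner ℝ (b - a) (X (γ k)) / (n + 1) := by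
      intro k hk
      have hk' : k + 1 ≤ n + 1 := by simpa using hk
      have m1 := hmem k (by omega)
      have m2 := hmem (k + 1) hk'
      have e1 := hf _ m1 _ m2
      have e2 := hf _ m2 _ m1
      have e3 := hg _ m1 _ m2
      have e4 := hg _ m2 _ m1
      rw [← neg_sub (γ (k + 1)), hstep] at e2 e4
      rw [hstep] at e1 e3
      simp only [inner_neg_left, real_inner_smul_left] at e1 e2 e3 e4
      rw [abs_le, div_eq_inv_mul, div_eq_inv_mul]
      simp only [one_div] at *
      constructor <;> linarith
    have hsum := Finset.abs_sum_le_sum_abs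
      (fun k => (f (γ (k + 1)) - g (γ (k + 1))) - (f (γ k) - g (γ k))) (Finset.range (n + 1))
    have hle := Finset.sum_le_sum hb'
    rw [Finset.sum_range_sub (fun k => f (γ k) - g (γ k))] at hsum
    rw [Finset.sum_range_sub (fun k => inner ℝ (b - a) (X (γ k)) / ((n : ℝ) + 1))] at hle
    rw [h0, h1] at hsum hle
    refine (hsum.trans hle).trans (le_of_eq ?_)
    rw [hL, inner_sub_right, sub_div]
  have hlim : Filter.Tendsto (fun n : ℕ => L / ((n : ℝ) + 1)) Filter.atTop (nhds 0) := by
    simpa using (tendsto_one_div_add_atTop_nhds_zero_nat (𝕜 := ℝ)).const_mul L |>.congr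
      (fun n => by ring)
  have := ge_of_tendsto' hlim key
  have := abs_nonpos_iff.mp this
  linarith

/-! ### Rockafellar's potential -/

section Rockafellar

variable {d : ℕ}

/-- The term of Rockafellar's potential attached to a permutation `σ` of a finite set `J` of
indices. -/
def rockafellarTerm (p : ℕ → Euc d × Euc d) (J : Finset ℕ) (σ : Equiv.Perm ℕ) (y : Euc d) : ℝ :=
  inner ℝ (y - (p 0).2) (p (σ 0)).1 + ∑ i ∈ J, inner ℝ ((p i).2 - (p (σ i)).2) (p (σ i)).1

/-- With `rockafellarPotential_le`, this trades permutations of a subtype for permutations of `ℕ`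
that preserve `J`. -/
theorem rockafellarTerm_le_rockafellarPotential (p : ℕ → Euc d × Euc d) {J : Finset ℕ}
    (h0 : 0 ∈ J) {σ : Equiv.Perm ℕ} (hσ : ∀ i, i ∈ J ↔ σ i ∈ J) (y : Euc d) :
    (rockafellarTerm p J σ y : EReal) ≤ rockafellarPotential p y := by
  have hJ : insert 0 J = J := Finset.insert_eq_of_mem h0
  have hσ' : ∀ i, i ∈ insert 0 J ↔ σ i ∈ insert 0 J := by rw [hJ]; exact hσ
  refine le_trans (le_of_eq ?_) (le_iSup₂ J (σ.subtypePerm fun i => (hσ' i).symm))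
  congr 1
  simp only [Equiv.Perm.subtypePerm_apply]
  rw [Finset.sum_coe_sort (insert 0 J)
    (fun i => inner ℝ ((p i).2 - (p (σ i)).2) (p (σ i)).1), hJ, rockafellarTerm, inner_sub_left]
  ring

theorem rockafellarPotential_le {p : ℕ → Euc d × Euc d} {y : Euc d} {c : EReal}
    (h : ∀ (J : Finset ℕ) (σ : Equiv.Perm ℕ), 0 ∈ J → (∀ i, i ∈ J ↔ σ i ∈ J) →
      (rockafellarTerm p J σ y : EReal) ≤ c) :
    rockafellarPotential p y ≤ c := by
  refine iSup₂_le fun I π => ?_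
  have hmem : ∀ i, i ∈ insert 0 I ↔ Equiv.Perm.ofSubtype π i ∈ insert 0 I := fun i =>
    (Equiv.Perm.ofSubtype_apply_mem_iff_mem π i).symm
  refine le_trans (le_of_eq ?_) (h (insert 0 I) (Equiv.Perm.ofSubtype π)
    (Finset.mem_insert_self 0 I) hmem)
  congr 1
  have h1 : ∀ i : {i // i ∈ insert 0 I}, ((π i : {i // i ∈ insert 0 I}) : ℕ)
      = Equiv.Perm.ofSubtype π (i : ℕ) := fun i => (Equiv.Perm.ofSubtype_apply_coe π i).symm
  simp only [h1]
  rw [Finset.sum_coe_sort (insert 0 I) (fun i => inner ℝ ((p i).2 - (p (Equiv.Perm.ofSubtype π i)).2)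
      (p (Equiv.Perm.ofSubtype π i)).1), rockafellarTerm, inner_sub_left]
  ring

theorem continuous_rockafellarTerm (p : ℕ → Euc d × Euc d) (J : Finset ℕ) (σ : Equiv.Perm ℕ) :
    Continuous (rockafellarTerm p J σ) := by
  unfold rockafellarTerm
  fun_prop

/-- A fresh index can be inserted in the cycle through `0`. -/
theorem rockafellarTerm_add_inner_le_of_notMem (p : ℕ → Euc d × Euc d) {J : Finset ℕ} (h0 : 0 ∈ J)
    {σ : Equiv.Perm ℕ} (hσ : ∀ i, i ∈ J ↔ σ i ∈ J) {k : ℕ} (hk : k ∉ J) (y : Euc d) :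
    ((rockafellarTerm p J σ (p k).2 + inner ℝ (y - (p k).2) (p k).1 : ℝ) : EReal)
      ≤ rockafellarPotential p y := by
  -- Off `J` the permutation `σ` is arbitrary, so it is replaced by the identity there; composing
  -- with the swap then yields `0 ↦ k ↦ σ 0`.
  set σ₁ : Equiv.Perm ℕ := Equiv.Perm.ofSubtype (σ.subtypePerm fun i => (hσ i).symm :
    Equiv.Perm {i // i ∈ J}) with hσ₁
  have e1 : ∀ i ∈ J, σ₁ i = σ i := fun i hi => by
    rw [hσ₁, Equiv.Perm.ofSubtype_apply_of_mem _ hi]; rfl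
  have e2 : ∀ i, i ∉ J → σ₁ i = i := fun i hi => Equiv.Perm.ofSubtype_apply_of_not_mem _ hi
  have hk0 : k ≠ 0 := fun h => hk (h ▸ h0)
  set τ : Equiv.Perm ℕ := σ₁ * Equiv.swap 0 k with hτ
  have t0 : τ 0 = k := by simp [hτ, e2 k hk]
  have tk : τ k = σ 0 := by simp [hτ, e1 0 h0]
  have ti : ∀ i ∈ J, i ≠ 0 → τ i = σ i := fun i hi hi0 => by
    have : i ≠ k := fun h => hk (h ▸ hi)
    simp [hτ, Equiv.swap_apply_of_ne_of_ne hi0 this, e1 i hi]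
  have tn : ∀ i, i ∉ insert k J → τ i = i := fun i hi => by
    simp only [Finset.mem_insert, not_or] at hi
    have : i ≠ 0 := fun h => hi.2 (h ▸ h0)
    simp [hτ, Equiv.swap_apply_of_ne_of_ne this hi.1, e2 i hi.2]
  have hmaps : ∀ i, i ∈ insert k J ↔ τ i ∈ insert k J := by
    intro i
    by_cases hi : i ∈ insert k J
    · refine iff_of_true hi ?_
      by_cases hik : i = k
      · rw [hik, tk]; exact Finset.mem_insert_of_mem ((hσ 0).1 h0)
      · have hiJ : i ∈ J := (Finset.mem_insert.1 hi).resolve_left hik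
        by_cases hi0 : i = 0
        · rw [hi0, t0]; exact Finset.mem_insert_self _ _
        · rw [ti i hiJ hi0]; exact Finset.mem_insert_of_mem ((hσ i).1 hiJ)
    · rw [tn i hi]
  refine le_trans (le_of_eq ?_) (rockafellarTerm_le_rockafellarPotential p
    (Finset.mem_insert_of_mem h0) hmaps y)
  congr 1
  unfold rockafellarTerm
  rw [Finset.sum_insert hk, t0, tk, ← Finset.add_sum_erase J _ h0,
    ← Finset.add_sum_erase J (fun i => inner ℝ ((p i).2 - (p (τ i)).2) (p (τ i)).1) h0, t0,
    Finset.sum_congr rfl (fun i hi => by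
      rw [ti i (Finset.mem_of_mem_erase hi) (Finset.ne_of_mem_erase hi)] :
      ∀ i ∈ J.erase 0, inner ℝ ((p i).2 - (p (τ i)).2) (p (τ i)).1
        = inner ℝ ((p i).2 - (p (σ i)).2) (p (σ i)).1)]
  simp only [inner_sub_left]
  ring

/-- Each inner product is at most an increment of `ψ`, and these increments cancel because `σ`
permutes `J`. -/
theorem rockafellarPotential_le_of_subgradient {N : Set (Euc d)} {ψ : Euc d → ℝ}
    {p : ℕ → Euc d × Euc d} (hp : ∀ i, ∀ y ∈ N, inner ℝ (y - (p i).2) (p i).1 ≤ ψ y - ψ (p i).2)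
    (hpN : ∀ i, (p i).2 ∈ N) {y : Euc d} (hy : y ∈ N) :
    rockafellarPotential p y ≤ ((ψ y - ψ (p 0).2 : ℝ) : EReal) := by
  refine rockafellarPotential_le fun J σ h0 hσ => ?_
  rw [EReal.coe_le_coe_iff, rockafellarTerm, ← Finset.add_sum_erase J _ h0, ← add_assoc,
    ← inner_add_left, sub_add_sub_cancel]
  have h1 : ∑ i ∈ J.erase 0, inner ℝ ((p i).2 - (p (σ i)).2) (p (σ i)).1
      ≤ ∑ i ∈ J.erase 0, (ψ (p i).2 - ψ (p (σ i)).2) :=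
    Finset.sum_le_sum fun i _ => hp _ _ (hpN i)
  have h2 : ∑ i ∈ J, (ψ (p i).2 - ψ (p (σ i)).2) = 0 := by
    rw [Finset.sum_sub_distrib, sub_eq_zero]
    symm
    refine Finset.sum_bij (fun i _ => σ i) (fun i hi => (hσ i).1 hi)
      (fun i _ j _ h => σ.injective h) (fun j hj => ⟨σ.symm j, (hσ _).2 (by simpa using hj), by simp⟩)
      (fun _ _ => rfl)
  rw [← Finset.add_sum_erase J _ h0] at h2
  have h3 := hp (σ 0) y hy
  linarith

theorem inner_le_rockafellarPotential (p : ℕ → Euc d × Euc d) (y : Euc d) :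
    ((inner ℝ (y - (p 0).2) (p 0).1 : ℝ) : EReal) ≤ rockafellarPotential p y := by
  refine le_trans (le_of_eq ?_) (rockafellarTerm_le_rockafellarPotential p (J := {0})
    (by simp) (σ := 1) (by simp) y)
  simp [rockafellarTerm]

/-- The potential of a sequence that repeats each of its points infinitely often has the points of
the closure of the sequence as subgradients. -/
theorem rockafellarTerm_add_inner_le {p : ℕ → Euc d × Euc d}
    (hrep : ∀ (n : ℕ) (J : Finset ℕ), ∃ k ∉ J, p k = p n) {q : Euc d × Euc d}
    (hq : q ∈ closure (range p)) {J : Finset ℕ} (h0 : 0 ∈ J)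
    {σ : Equiv.Perm ℕ} (hσ : ∀ i, i ∈ J ↔ σ i ∈ J) (y : Euc d) :
    ((rockafellarTerm p J σ q.2 + inner ℝ (y - q.2) q.1 : ℝ) : EReal)
      ≤ rockafellarPotential p y := by
  -- A fresh copy of a point of the sequence gives the bound at that point; the condition is closed
  -- in `q`, which gives the closure.
  have hclosed : IsClosed {q : Euc d × Euc d |
      ((rockafellarTerm p J σ q.2 + inner ℝ (y - q.2) q.1 : ℝ) : EReal)
        ≤ rockafellarPotential p y} := by
    refine isClosed_le (continuous_coe_real_ereal.comp ?_) continuous_const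
    have := continuous_rockafellarTerm p J σ
    fun_prop
  refine hclosed.closure_subset_iff.2 ?_ hq
  rintro _ ⟨n, rfl⟩
  obtain ⟨k, hk, hkn⟩ := hrep n J
  rw [← hkn]
  exact rockafellarTerm_add_inner_le_of_notMem p h0 hσ hk y

/-- A convex function is the Rockafellar potential of a sequence that is dense enough in the graph
of its subdifferential. -/
theorem rockafellarPotential_eq {N S : Set (Euc d)} {ψ : Euc d → ℝ} {X : Euc d → Euc d}
    {p : ℕ → Euc d × Euc d}
    (hp : ∀ i, ∀ y ∈ N, inner ℝ (y - (p i).2) (p i).1 ≤ ψ y - ψ (p i).2)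
    (hpN : ∀ i, (p i).2 ∈ N) (hp0 : p 0 = (0, 0)) (hψ0 : ψ 0 = 0)
    (hrep : ∀ (n : ℕ) (J : Finset ℕ), ∃ k ∉ J, p k = p n)
    (hS : Convex ℝ S) (hSN : S ⊆ N) (h0S : 0 ∈ S)
    (hX : ∀ y ∈ S, ∀ z ∈ S, ψ y + inner ℝ (z - y) (X y) ≤ ψ z)
    (hXp : ∀ y ∈ S, (X y, y) ∈ closure (range p)) (hNS : ∀ y ∈ N, y ∉ S → ψ y ≤ 0)
    {y : Euc d} (hy : y ∈ N) : rockafellarPotential p y = ψ y := by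
  have hup : ∀ y ∈ N, rockafellarPotential p y ≤ ψ y := fun y hy => by
    simpa [hp0, hψ0] using rockafellarPotential_le_of_subgradient hp hpN hy
  have hlow : ∀ y, 0 ≤ rockafellarPotential p y := fun y => by
    simpa [hp0] using inner_le_rockafellarPotential p y
  -- Off `S` no subgradient is available, but the potential is squeezed between `0` and `ψ y ≤ 0`.
  by_cases hyS : y ∉ S
  · exact le_antisymm (hup y hy) ((EReal.coe_nonpos.2 (hNS y hy hyS)).trans (hlow y))
  rw [not_not] at hyS
  have hcoe : ∀ y ∈ N, ((rockafellarPotential p y).toReal : EReal) = rockafellarPotential p y :=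
    fun y hy => EReal.coe_toReal (ne_top_of_le_ne_top (EReal.coe_ne_top _) (hup y hy))
      (ne_bot_of_le_ne_bot EReal.zero_ne_bot (hlow y))
  have hsub : ∀ y ∈ S, ∀ z ∈ S, (rockafellarPotential p y).toReal + inner ℝ (z - y) (X y)
      ≤ (rockafellarPotential p z).toReal := by
    intro y hy z hz
    rw [← le_sub_iff_add_le, ← EReal.coe_le_coe_iff, hcoe y (hSN hy)]
    refine rockafellarPotential_le fun J σ h0 hσ => ?_
    rw [EReal.coe_le_coe_iff, le_sub_iff_add_le, ← EReal.coe_le_coe_iff, hcoe z (hSN hz)]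
    exact rockafellarTerm_add_inner_le hrep (hXp y hy) h0 hσ z
  have h := sub_eq_sub_of_common_subgradient hS hsub hX hyS h0S
  have h00 : rockafellarPotential p 0 = 0 :=
    le_antisymm (by simpa [hψ0] using hup 0 (hSN h0S)) (hlow 0)
  rw [h00, hψ0, EReal.toReal_zero, sub_zero, sub_eq_zero] at h
  rw [← hcoe y hy, h]

/-- The value `⊥` is excluded because `⊥ + ⊤ = ⊥` in `EReal`, which would spoil the indicator off
`N`. -/
theorem legendreTransform_add_convexIndicator {N : Set (Euc d)} {ψ : Euc d → ℝ}
    {F : Euc d → Euc d} (h : IsLegendreSelection N ψ F) {g : Euc d → EReal}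
    (hg : ∀ y ∈ N, g y = ψ y) (hbot : ∀ y, g y ≠ ⊥) (x : Euc d) :
    legendreTransform (fun y => g y + convexIndicator N y) x = legendreValue ψ F x := by
  unfold legendreTransform
  refine le_antisymm (iSup_le fun y => ?_) ?_
  · by_cases hy : y ∈ N
    · simp only [convexIndicator, if_pos hy, add_zero, hg y hy]
      rw [← EReal.coe_sub, EReal.coe_le_coe_iff]
      exact (h x).2 y hy
    · simp only [convexIndicator, if_neg hy]
      rw [EReal.add_top_of_ne_bot (hbot y), EReal.sub_top]
      exact bot_le
  · refine le_trans (le_of_eq ?_) (le_iSup _ (F x))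
    simp only [convexIndicator, if_pos (h x).1, add_zero, hg _ (h x).1]
    rw [← EReal.coe_sub, legendreValue]

end Rockafellar

/-! ### From a maximizer selection to a Brenier distribution function -/

section Representation

variable {d : ℕ}

/-- Every set in a second countable space has a dense sequence that starts at a given point and
repeats each of its values infinitely often. -/
theorem exists_dense_seq_repeating {α : Type*} [TopologicalSpace α] [SecondCountableTopology α]
    {G : Set α} {a : α} (ha : a ∈ G) :
    ∃ p : ℕ → α, (∀ i, p i ∈ G) ∧ G ⊆ closure (range p) ∧ p 0 = a ∧
      ∀ (n : ℕ) (J : Finset ℕ), ∃ k ∉ J, p k = p n := by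
  have : Nonempty G := ⟨⟨a, ha⟩⟩
  obtain ⟨u, hu⟩ := TopologicalSpace.exists_dense_seq G
  -- Since `Nat.unpair 0 = (0, 0)`, the value `q 0` also becomes the initial point.
  let q : ℕ → G := fun n => if n = 0 then ⟨a, ha⟩ else u (n - 1)
  refine ⟨fun n => q n.unpair.1, fun i => (q _).2, ?_, by simp [q], ?_⟩
  · intro x hx
    have h1 : (⟨x, hx⟩ : G) ∈ closure (range u) := hu _
    rw [closure_subtype] at h1
    refine closure_mono ?_ h1
    rintro _ ⟨_, ⟨n, rfl⟩, rfl⟩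
    exact ⟨Nat.pair (n + 1) 0, by simp [q]⟩
  · intro n J
    refine ⟨Nat.pair n.unpair.1 (J.sup id + 1), fun h => ?_, by simp⟩
    have h1 : Nat.pair n.unpair.1 (J.sup id + 1) ≤ J.sup id := Finset.le_sup (f := id) h
    have h2 := Nat.right_le_pair n.unpair.1 (J.sup id + 1)
    omega

theorem isLebesgueRepresentation_of_isLegendreSelection {μ ν : Measure (Euc d)}
    {T F X : Euc d → Euc d} {ψ : Euc d → ℝ} {S : Set (Euc d)}
    (hν : ν.support ⊆ Metric.closedBall 0 1)
    (hT : IsLegendreSelection ν.support ψ T) (hF : IsLegendreSelection ν.support ψ F)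
    (h0 : 0 ∈ μ.support) (hT0 : T 0 = 0) (hψ0 : ψ 0 = 0)
    (hS : Convex ℝ S) (hSN : S ⊆ ν.support) (h0S : 0 ∈ S)
    (hX : ∀ y ∈ S, ∀ z ∈ S, ψ y + inner ℝ (z - y) (X y) ≤ ψ z)
    (hXT : ∀ y ∈ S, (X y, y) ∈ closure (graphOver T μ.support))
    (hNS : ∀ y ∈ ν.support, y ∉ S → ψ y ≤ 0) :
    IsLebesgueRepresentation μ ν T F := by
  obtain ⟨p, hpG, hpd, hp0, hrep⟩ := exists_dense_seq_repeating
    (show ((0 : Euc d), (0 : Euc d)) ∈ graphOver T μ.support from ⟨0, h0, by simp only [hT0]⟩)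
  have hp : ∀ i, (p i).2 = T (p i).1 := fun i => by
    obtain ⟨x, _, hx⟩ := hpG i
    rw [← hx]
  have hlow : ∀ y, rockafellarPotential p y ≠ ⊥ := fun y =>
    ne_bot_of_le_ne_bot (EReal.coe_ne_bot _) (inner_le_rockafellarPotential p y)
  have hpot : ∀ y ∈ ν.support, rockafellarPotential p y = ψ y := fun y hy => by
    refine rockafellarPotential_eq (N := ν.support) (S := S) (X := X) ?_ ?_ hp0 hψ0 hrep hS hSN
      h0S hX (fun y hy => closure_minimal hpd isClosed_closure (hXT y hy)) hNS hy
    · intro i z hz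
      have := (hT (p i).1).2 z hz
      rw [hp i, real_inner_comm, inner_sub_right]
      linarith
    · intro i
      rw [hp i]
      exact (hT _).1
  have hleg := legendreTransform_add_convexIndicator hF hpot hlow
  refine ⟨p, hpG, hpd, ?_, fun x z => ?_⟩
  · simp only [hleg, EReal.toReal_coe]
    exact hF.ae_hasGradientAt hν
  · simp only [hleg]
    rw [← EReal.coe_add, EReal.coe_le_coe_iff]
    exact hF.legendreValue_add_inner_le x z

/-- A maximizer selection in the Legendre transform of `ψ` is a Brenier distribution function of
the image of `ν` under a selection `X` of subgradients of `ψ`. -/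
theorem isBDF_of_isLegendreSelection {μ ν : Measure (Euc d)} [IsProbabilityMeasure ν]
    {F X : Euc d → Euc d} {ψ : Euc d → ℝ} {S V : Set (Euc d)}
    (hν : ν.support = Metric.closedBall 0 1) (hνac : ν ≪ volume)
    (hμ : ν.map X = μ) (hμac : μ ≪ volume) (hXm : Measurable X)
    (hF : IsLegendreSelection (Metric.closedBall 0 1) ψ F)
    (hψ : ∀ y ∈ Metric.closedBall (0 : Euc d) 1, 0 ≤ ψ y) (hψ0 : ψ 0 = 0)
    (hS : Convex ℝ S) (hSN : S ⊆ Metric.closedBall 0 1) (h0S : 0 ∈ S) (hX0 : X 0 = 0)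
    (hX : ∀ y ∈ S, ∀ z ∈ S, ψ y + inner ℝ (z - y) (X y) ≤ ψ z)
    (hXS : ContinuousOn X S) (hVS : V ⊆ S) (hVo : IsOpen V) (hSV : S ⊆ closure V)
    (hVae : ∀ᵐ y ∂ν, y ∈ V) (hFX : ∀ y ∈ V, F (X y) = y) (hV0 : ∀ y ∈ V, X y ≠ 0)
    (hNS : ∀ y ∈ Metric.closedBall 0 1, y ∉ S → ψ y ≤ 0) : IsBDF μ ν F := by
  -- The value of `F` at `0` is only some maximizer; resetting it to `0` puts the base point `(0,
  -- 0)` into the graph.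
  have hT : IsLegendreSelection (Metric.closedBall 0 1) ψ (Function.update F 0 0) := by
    refine hF.update (by simp) fun y hy => ?_
    simpa [hψ0] using hψ y hy
  set T := Function.update F 0 0 with hTdef
  have hTX : ∀ y ∈ V, T (X y) = y := fun y hy => by
    rw [hTdef, Function.update_of_ne (hV0 y hy), hFX y hy]
  have hTm : AEMeasurable T μ := (hT.aemeasurable subset_rfl).mono_ac hμac
  have hmapT : μ.map T = ν := by
    rw [← hμ] at hTm ⊢
    rw [AEMeasurable.map_map_of_aemeasurable hTm hXm.aemeasurable]
    conv_rhs => rw [← Measure.map_id (μ := ν)]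
    refine Measure.map_congr ?_
    filter_upwards [hVae] with y hy using hTX y hy
  -- On the open set `V` the map `X` is continuous, so it carries points of the support of `ν` to
  -- points of the support of `μ`.
  have hsuppV : ∀ y ∈ V, X y ∈ μ.support := by
    intro y hy
    rw [Measure.mem_support_iff_forall]
    intro U hU
    have h1 : X ⁻¹' U ∈ nhds y :=
      (hXS.continuousAt (Filter.mem_of_superset (hVo.mem_nhds hy) hVS)).preimage_mem_nhds hU
    have h2 : y ∈ ν.support := by rw [hν]; exact hSN (hVS hy)
    rw [Measure.mem_support_iff_forall] at h2
    rw [← hμ]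
    exact (h2 _ h1).trans_le (Measure.le_map_apply hXm.aemeasurable U)
  have hcl : ∀ y ∈ S, (X y, y) ∈ closure (graphOver T μ.support) := by
    intro y hy
    have h1 : ContinuousWithinAt (fun y => (X y, y)) V y :=
      ((hXS y hy).prodMk continuousWithinAt_id).mono hVS
    refine closure_mono ?_ (h1.mem_closure_image (hSV hy))
    rintro _ ⟨z, hz, rfl⟩
    exact ⟨X z, hsuppV z hz, by simp only [hTX z hz]⟩
  have h0μ : 0 ∈ μ.support := by
    have h1 : ContinuousWithinAt X V 0 := (hXS 0 h0S).mono hVS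
    have h2 := h1.mem_closure_image (hSV h0S)
    rw [hX0] at h2
    refine closure_minimal ?_ Measure.isClosed_support h2
    rintro _ ⟨z, hz, rfl⟩
    exact hsuppV z hz
  refine ⟨?_, hμac, inferInstance, hνac, ?_, ?_, T, ?_, hT.cyclicallyMonotoneOn _, hTm, hmapT, ?_⟩
  · rw [← hμ]; exact Measure.isProbabilityMeasure_map hXm.aemeasurable
  · rw [hν]; exact isCompact_closedBall _ _
  · rw [hν]; exact convex_closedBall _ _
  · intro x _; rw [hν]; exact (hT x).1
  · rw [← hν] at hT hF hSN hNS
    exact isLebesgueRepresentation_of_isLegendreSelection hν.le hT hF h0μ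
      (by simp [hTdef]) hψ0 hS hSN h0S hX hcl hNS

end Representation

/-! ### The uniform distribution on the ball -/

section UniformBall

instance (d : ℕ) : IsProbabilityMeasure (uniformUnitBall d) :=
  ProbabilityTheory.cond_isProbabilityMeasure_of_finite
    (Metric.measure_closedBall_pos volume 0 one_pos).ne'
    (isCompact_closedBall (0 : Euc d) 1).measure_lt_top.ne

theorem uniformUnitBall_absolutelyContinuous (d : ℕ) : uniformUnitBall d ≪ volume :=
  ProbabilityTheory.cond_absolutelyContinuous

theorem support_uniformUnitBall (d : ℕ) :
    (uniformUnitBall d).support = Metric.closedBall 0 1 := by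
  refine Subset.antisymm ?_ ?_
  · refine Measure.support_subset_of_isClosed Metric.isClosed_closedBall ?_
    exact ProbabilityTheory.ae_cond_mem measurableSet_closedBall
  · rw [← closure_ball (0 : Euc d) one_ne_zero]
    refine closure_minimal (fun y hy => ?_) Measure.isClosed_support
    rw [Measure.mem_support_iff_forall]
    intro U hU
    rw [uniformUnitBall, ProbabilityTheory.cond_apply measurableSet_closedBall]
    refine ENNReal.mul_pos
      (ENNReal.inv_ne_zero.2 (isCompact_closedBall (0 : Euc d) 1).measure_lt_top.ne) ?_
    refine (Measure.measure_pos_of_mem_nhds volume (x := y) (Filter.inter_mem ?_ hU)).ne'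
    exact Filter.mem_of_superset (Metric.isOpen_ball.mem_nhds hy) Metric.ball_subset_closedBall

end UniformBall

/-! ### The potential on the disc and its gradient -/

section Plane

theorem inner_euc_two (x y : Euc 2) : inner ℝ x y = x 0 * y 0 + x 1 * y 1 := by
  rw [PiLp.inner_apply, Fin.sum_univ_two]
  simp [mul_comm]

theorem norm_sq_euc_two (x : Euc 2) : ‖x‖ ^ 2 = x 0 ^ 2 + x 1 ^ 2 := by
  rw [EuclideanSpace.real_norm_sq_eq, Fin.sum_univ_two]

theorem mem_closedBall_euc_two {y : Euc 2} :
    y ∈ Metric.closedBall (0 : Euc 2) 1 ↔ y 0 ^ 2 + y 1 ^ 2 ≤ 1 := by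
  rw [mem_closedBall_zero_iff, ← norm_sq_euc_two, sq_le_one_iff₀ (norm_nonneg _)]

theorem euc_two_ext {x y : Euc 2} (h0 : x 0 = y 0) (h1 : x 1 = y 1) : x = y := by
  ext i
  fin_cases i
  · exact h0
  · exact h1

theorem volume_setOf_apply_one_eq_zero : volume {y : Euc 2 | y 1 = 0} = 0 := by
  let L : Euc 2 →ₗ[ℝ] ℝ := (EuclideanSpace.proj (1 : Fin 2) : Euc 2 →L[ℝ] ℝ).toLinearMap
  have h : (LinearMap.ker L : Set (Euc 2)) = {y : Euc 2 | y 1 = 0} := by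
    ext y; simp [L]
  rw [← h]
  refine Measure.addHaar_submodule volume _ fun htop => ?_
  have : (!₂[0, 1] : Euc 2) ∈ LinearMap.ker L := by rw [htop]; trivial
  simp [L] at this

/-- The convex function `y₁² / (2 (a - y₀²))`. -/
def planePotential (a : ℝ) (y : Euc 2) : ℝ := y 1 ^ 2 / (2 * (a - y 0 ^ 2))

/-- The gradient of `planePotential a`. -/
def planeGradient (a : ℝ) (y : Euc 2) : Euc 2 :=
  !₂[y 0 * y 1 ^ 2 / (a - y 0 ^ 2) ^ 2, y 1 / (a - y 0 ^ 2)]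

/-- The inverse of `planeGradient a`. -/
def planeInverse (a : ℝ) (x : Euc 2) : Euc 2 :=
  !₂[x 0 / x 1 ^ 2, x 1 * (a - (x 0 / x 1 ^ 2) ^ 2)]

/-- The part of the closed unit disc on which `planePotential a` is smooth. -/
def planeDomain (a : ℝ) : Set (Euc 2) := {y | y ∈ Metric.closedBall (0 : Euc 2) 1 ∧ y 0 ^ 2 < a}

/-- The open unit disc without its horizontal diameter. -/
def slitDisc : Set (Euc 2) := {y | y ∈ Metric.ball (0 : Euc 2) 1 ∧ y 1 ≠ 0}

theorem planePotential_zero (a : ℝ) : planePotential a 0 = 0 := by simp [planePotential]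

theorem planeGradient_zero (a : ℝ) : planeGradient a 0 = 0 := by
  apply euc_two_ext <;> simp [planeGradient]

theorem planePotential_nonneg {a : ℝ} (ha : 1 ≤ a) {y : Euc 2}
    (hy : y ∈ Metric.closedBall (0 : Euc 2) 1) : 0 ≤ planePotential a y := by
  rw [mem_closedBall_euc_two] at hy
  have : 0 ≤ a - y 0 ^ 2 := by nlinarith [sq_nonneg (y 1)]
  unfold planePotential
  positivity

/-- Maximizing the second variable in the Legendre transform of `planePotential a`. -/
theorem mul_sub_planePotential_le {a : ℝ} {y : Euc 2} (hy : 0 ≤ a - y 0 ^ 2)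
    (hy' : a - y 0 ^ 2 = 0 → y 1 = 0) (b : ℝ) :
    b * y 1 - planePotential a y ≤ (a - y 0 ^ 2) * b ^ 2 / 2 := by
  unfold planePotential
  rcases hy.eq_or_lt with h | h
  · rw [hy' h.symm, ← h]; simp
  · have : (a - y 0 ^ 2) * b ^ 2 / 2 - (b * y 1 - y 1 ^ 2 / (2 * (a - y 0 ^ 2)))
        = (y 1 - b * (a - y 0 ^ 2)) ^ 2 / (2 * (a - y 0 ^ 2)) := by
      field_simp; ring
    have h2 : 0 ≤ (y 1 - b * (a - y 0 ^ 2)) ^ 2 / (2 * (a - y 0 ^ 2)) := by positivity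
    linarith

/-- The gap vanishes only for `a = 1` at `(±1, 0)`; there `0 / 0 = 0` is the correct value of the
supremum over `b`. -/
theorem closedBall_gap {a : ℝ} (ha : 1 ≤ a) {y : Euc 2}
    (hy : y ∈ Metric.closedBall (0 : Euc 2) 1) :
    0 ≤ a - y 0 ^ 2 ∧ (a - y 0 ^ 2 = 0 → y 1 = 0) := by
  rw [mem_closedBall_euc_two] at hy
  refine ⟨by nlinarith [sq_nonneg (y 1)], fun h => ?_⟩
  have : y 1 ^ 2 = 0 := le_antisymm (by linarith) (sq_nonneg _)
  exact pow_eq_zero_iff two_ne_zero |>.1 this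

theorem inner_planeGradient_sub {a : ℝ} {y : Euc 2} (hy : 0 < a - y 0 ^ 2) :
    inner ℝ (planeGradient a y) y - planePotential a y
      = (y 1 / (a - y 0 ^ 2)) ^ 2 * (a + y 0 ^ 2) / 2 := by
  rw [inner_euc_two]
  simp only [planeGradient, planePotential, PiLp.toLp_apply, Matrix.cons_val_zero,
    Matrix.cons_val_one]
  field_simp
  ring

/-- Take `b = y₁ / (a - y₀²)`: the gradient at `y` is `(y₀ b², b)`, and completing the square in
`z₀` isolates the deficit `b² (z₀ - y₀)² / 2`. -/
theorem inner_planeGradient_sub_le {a : ℝ} (ha : 1 ≤ a) {y z : Euc 2}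
    (hz : z ∈ Metric.closedBall (0 : Euc 2) 1) :
    inner ℝ (planeGradient a y) z - planePotential a z
      ≤ (y 1 / (a - y 0 ^ 2)) ^ 2 * (a + y 0 ^ 2 - (z 0 - y 0) ^ 2) / 2 := by
  have h := mul_sub_planePotential_le (closedBall_gap ha hz).1 (closedBall_gap ha hz).2
    (y 1 / (a - y 0 ^ 2))
  rw [inner_euc_two]
  simp only [planeGradient, PiLp.toLp_apply, Matrix.cons_val_zero, Matrix.cons_val_one]
  have e : y 0 * y 1 ^ 2 / (a - y 0 ^ 2) ^ 2 = y 0 * (y 1 / (a - y 0 ^ 2)) ^ 2 := by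
    rw [div_pow]; ring
  rw [e]
  linarith

theorem planePotential_add_inner_le {a : ℝ} (ha : 1 ≤ a) {y z : Euc 2} (hy : y 0 ^ 2 < a)
    (hz : z ∈ Metric.closedBall (0 : Euc 2) 1) :
    planePotential a y + inner ℝ (z - y) (planeGradient a y) ≤ planePotential a z := by
  have h1 := inner_planeGradient_sub (sub_pos.2 hy)
  have h2 := inner_planeGradient_sub_le ha (y := y) hz
  have h3 : 0 ≤ (y 1 / (a - y 0 ^ 2)) ^ 2 * (z 0 - y 0) ^ 2 := by positivity
  rw [real_inner_comm, inner_sub_right]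
  linarith

/-- When `y₁ ≠ 0` the maximizer is unique: the deficit in the first coordinate forces `z₀ = y₀`,
then strict concavity in the second forces `z₁ = y₁`. -/
theorem eq_of_isLegendreSelection {a : ℝ} (ha : 1 ≤ a) {F : Euc 2 → Euc 2}
    (hF : IsLegendreSelection (Metric.closedBall 0 1) (planePotential a) F) {y : Euc 2}
    (hy : y ∈ Metric.closedBall (0 : Euc 2) 1) (hy1 : y 1 ≠ 0) : F (planeGradient a y) = y := by
  obtain ⟨hz, hmax⟩ := hF (planeGradient a y)
  set z := F (planeGradient a y)
  have hpos : 0 < a - y 0 ^ 2 :=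
    (closedBall_gap ha hy).1.lt_of_ne fun h => hy1 ((closedBall_gap ha hy).2 h.symm)
  have h1 := inner_planeGradient_sub hpos
  have h2 := inner_planeGradient_sub_le ha (y := y) hz
  have h3 := hmax y hy
  have hb : y 1 / (a - y 0 ^ 2) ≠ 0 := div_ne_zero hy1 hpos.ne'
  have hb2 : 0 < (y 1 / (a - y 0 ^ 2)) ^ 2 := by positivity
  have h0 : (z 0 - y 0) ^ 2 = 0 := by
    refine le_antisymm ?_ (sq_nonneg _)
    by_contra hlt
    have := mul_pos hb2 (not_le.1 hlt)
    linarith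
  have hz0 : z 0 = y 0 := sub_eq_zero.1 (pow_eq_zero_iff two_ne_zero |>.1 h0)
  refine euc_two_ext hz0 ?_
  rw [inner_euc_two, inner_euc_two] at h3
  simp only [planeGradient, planePotential, hz0, PiLp.toLp_apply, Matrix.cons_val_zero,
    Matrix.cons_val_one] at h3
  have h4 : (z 1 - y 1) ^ 2 / (2 * (a - y 0 ^ 2)) ≤ 0 := by
    have e : (z 1 - y 1) ^ 2 / (2 * (a - y 0 ^ 2)) = (y 1 / (a - y 0 ^ 2) * y 1
        - y 1 ^ 2 / (2 * (a - y 0 ^ 2))) - (y 1 / (a - y 0 ^ 2) * z 1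
        - z 1 ^ 2 / (2 * (a - y 0 ^ 2))) := by field_simp; ring
    rw [e]; linarith
  have h5 : (z 1 - y 1) ^ 2 ≤ 0 := by
    by_contra hlt
    exact absurd h4 (not_le.2 (div_pos (not_le.1 hlt) (by positivity)))
  exact sub_eq_zero.1 (pow_eq_zero_iff two_ne_zero |>.1 (le_antisymm h5 (sq_nonneg _)))

theorem measurable_planeGradient (a : ℝ) : Measurable (planeGradient a) := by
  refine (MeasurableEquiv.toLp 2 (Fin 2 → ℝ)).measurable.comp (measurable_pi_iff.2 fun i => ?_)
  fin_cases i
  · simp only [Fin.zero_eta, Matrix.cons_val_zero]; fun_prop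
  · simp only [Fin.mk_one, Matrix.cons_val_one, Matrix.cons_val_zero]; fun_prop

theorem measurable_planeInverse (a : ℝ) : Measurable (planeInverse a) := by
  refine (MeasurableEquiv.toLp 2 (Fin 2 → ℝ)).measurable.comp (measurable_pi_iff.2 fun i => ?_)
  fin_cases i
  · simp only [Fin.zero_eta, Matrix.cons_val_zero]; fun_prop
  · simp only [Fin.mk_one, Matrix.cons_val_one, Matrix.cons_val_zero]; fun_prop

theorem continuousOn_planeGradient (a : ℝ) : ContinuousOn (planeGradient a) (planeDomain a) := by
  refine (PiLp.continuous_toLp 2 _).comp_continuousOn (continuousOn_pi.2 fun i => ?_)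
  have h : ∀ y ∈ planeDomain a, a - y 0 ^ 2 ≠ 0 := fun y hy => (sub_pos.2 hy.2).ne'
  fin_cases i
  · simp only [Fin.zero_eta, Matrix.cons_val_zero]
    exact ContinuousOn.div (by fun_prop) (by fun_prop) fun y hy => pow_ne_zero _ (h y hy)
  · simp only [Fin.mk_one, Matrix.cons_val_one, Matrix.cons_val_zero]
    exact ContinuousOn.div (by fun_prop) (by fun_prop) h

theorem convex_planeDomain (a : ℝ) : Convex ℝ (planeDomain a) := by
  have h1 : ConvexOn ℝ univ (fun y : Euc 2 => (EuclideanSpace.proj (0 : Fin 2) : Euc 2 →L[ℝ] ℝ) y ^ 2) :=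
    ((even_two.convexOn_pow (𝕜 := ℝ)).comp_linearMap
      (EuclideanSpace.proj (0 : Fin 2) : Euc 2 →L[ℝ] ℝ).toLinearMap)
  have h2 := (convex_closedBall (0 : Euc 2) 1).inter (h1.convex_lt a)
  refine (congrArg (Convex ℝ) ?_).mp h2
  ext y; simp [planeDomain]

theorem isOpen_slitDisc : IsOpen slitDisc :=
  Metric.isOpen_ball.inter (isOpen_ne_fun (by fun_prop) continuous_const)

theorem slitDisc_subset_planeDomain {a : ℝ} (ha : 1 ≤ a) : slitDisc ⊆ planeDomain a := by
  intro y hy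
  have h := Metric.ball_subset_closedBall hy.1
  exact ⟨h, sub_pos.1 ((closedBall_gap ha h).1.lt_of_ne
    fun e => hy.2 ((closedBall_gap ha h).2 e.symm))⟩

theorem closedBall_subset_closure_slitDisc :
    Metric.closedBall (0 : Euc 2) 1 ⊆ closure slitDisc := by
  have hd : Dense {y : Euc 2 | y 1 ≠ 0} :=
    Measure.dense_of_ae (measure_eq_zero_iff_ae_notMem.1 volume_setOf_apply_one_eq_zero)
  rw [← closure_ball (0 : Euc 2) one_ne_zero]
  exact closure_minimal (hd.open_subset_closure_inter Metric.isOpen_ball) isClosed_closure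

theorem ae_mem_slitDisc : ∀ᵐ y ∂(uniformUnitBall 2), y ∈ slitDisc := by
  have h1 : ∀ᵐ y ∂(uniformUnitBall 2), y ∈ Metric.closedBall (0 : Euc 2) 1 :=
    ProbabilityTheory.ae_cond_mem measurableSet_closedBall
  have h2 : ∀ᵐ y ∂(uniformUnitBall 2), y ∉ Metric.sphere (0 : Euc 2) 1 :=
    (uniformUnitBall_absolutelyContinuous 2).ae_le
      (measure_eq_zero_iff_ae_notMem.1 (Measure.addHaar_sphere volume (0 : Euc 2) 1))
  have h3 : ∀ᵐ y ∂(uniformUnitBall 2), y ∉ {y : Euc 2 | y 1 = 0} :=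
    (uniformUnitBall_absolutelyContinuous 2).ae_le
      (measure_eq_zero_iff_ae_notMem.1 volume_setOf_apply_one_eq_zero)
  filter_upwards [h1, h2, h3] with y h1 h2 h3
  refine ⟨?_, h3⟩
  rw [← Metric.closedBall_sdiff_sphere]
  exact ⟨h1, h2⟩

theorem isBDF_planeGradient {a : ℝ} (ha : 1 ≤ a) {μ : Measure (Euc 2)} {F : Euc 2 → Euc 2}
    (hμ : (uniformUnitBall 2).map (planeGradient a) = μ) (hμac : μ ≪ volume)
    (hF : IsLegendreSelection (Metric.closedBall 0 1) (planePotential a) F) :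
    IsBDF μ (uniformUnitBall 2) F := by
  refine isBDF_of_isLegendreSelection (support_uniformUnitBall 2)
    (uniformUnitBall_absolutelyContinuous 2) hμ hμac (measurable_planeGradient a) hF
    (fun y hy => planePotential_nonneg ha hy) (planePotential_zero a) (convex_planeDomain a)
    (fun y hy => hy.1) ⟨by simp, by simpa using by linarith⟩ (planeGradient_zero a)
    (fun y hy z hz => planePotential_add_inner_le ha hy.2 hz.1) (continuousOn_planeGradient a)
    (slitDisc_subset_planeDomain ha) isOpen_slitDisc
    (fun y hy => closedBall_subset_closure_slitDisc hy.1) ae_mem_slitDisc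
    (fun y hy => eq_of_isLegendreSelection ha hF (Metric.ball_subset_closedBall hy.1) hy.2)
    (fun y hy h => ?_) (fun y hy hyS => ?_)
  · have h1 : planeGradient a y 1 = 0 := by rw [h]; rfl
    simp only [planeGradient, PiLp.toLp_apply, Matrix.cons_val_one] at h1
    have h2 := (slitDisc_subset_planeDomain ha hy).2
    rcases div_eq_zero_iff.1 h1 with h3 | h3
    · exact hy.2 h3
    · linarith
  · have h1 := closedBall_gap ha hy
    have h2 : a - y 0 ^ 2 = 0 :=
      le_antisymm (sub_nonpos.2 (not_lt.1 fun h => hyS ⟨hy, h⟩)) h1.1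
    simp [planePotential, h1.2 h2]

end Plane

/-! ### The map of the example as a maximizer selection -/

section Example

theorem planeGradient_planeInverse {a : ℝ} {x : Euc 2} (hx : x 1 ≠ 0)
    (ha : a - (x 0 / x 1 ^ 2) ^ 2 ≠ 0) : planeGradient a (planeInverse a x) = x := by
  apply euc_two_ext <;> simp only [planeGradient, planeInverse, PiLp.toLp_apply,
    Matrix.cons_val_zero, Matrix.cons_val_one]
  · rw [mul_pow, ← mul_assoc, mul_div_cancel_right₀ _ (pow_ne_zero 2 ha)]
    field_simp
  · rw [mul_div_cancel_right₀ _ ha]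

theorem planeInverse_planeGradient {a : ℝ} {y : Euc 2} (hy : y 1 ≠ 0) (ha : a - y 0 ^ 2 ≠ 0) :
    planeInverse a (planeGradient a y) = y := by
  have e : y 0 * y 1 ^ 2 / (a - y 0 ^ 2) ^ 2 / (y 1 / (a - y 0 ^ 2)) ^ 2 = y 0 := by
    field_simp
  apply euc_two_ext <;> simp only [planeGradient, planeInverse, PiLp.toLp_apply,
    Matrix.cons_val_zero, Matrix.cons_val_one, e]
  rw [div_mul_cancel₀ _ ha]

/-- The derivative of `planeInverse 1`. -/
def planeInverseDeriv (x : Euc 2) : Euc 2 →L[ℝ] Euc 2 :=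
  Matrix.toEuclideanCLM (𝕜 := ℝ) (n := Fin 2)
    !![1 / x 1 ^ 2, -2 * x 0 / x 1 ^ 3; -2 * x 0 / x 1 ^ 3, 1 + 3 * x 0 ^ 2 / x 1 ^ 4]

theorem det_planeInverseDeriv {x : Euc 2} (hx : x 1 ≠ 0) :
    (planeInverseDeriv x).det = (x 1 ^ 4 - x 0 ^ 2) / x 1 ^ 6 := by
  rw [planeInverseDeriv, ContinuousLinearMap.det, Matrix.coe_toEuclideanCLM_eq_toEuclideanLin,
    Matrix.toEuclideanLin, Matrix.toLpLin_eq_toLin, LinearMap.det_toLin, Matrix.det_fin_two_of]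
  field_simp
  ring

theorem hasFDerivAt_planeInverse {x : Euc 2} (hx : x 1 ≠ 0) :
    HasFDerivAt (planeInverse 1) (planeInverseDeriv x) x := by
  have h0 : HasFDerivAt (fun x : Euc 2 => x 0)
      (EuclideanSpace.proj 0 : Euc 2 →L[ℝ] ℝ) x :=
    (EuclideanSpace.proj 0 : Euc 2 →L[ℝ] ℝ).hasFDerivAt
  have h1 : HasFDerivAt (fun x : Euc 2 => x 1)
      (EuclideanSpace.proj 1 : Euc 2 →L[ℝ] ℝ) x :=
    (EuclideanSpace.proj 1 : Euc 2 →L[ℝ] ℝ).hasFDerivAt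
  have hu := h0.mul ((hasDerivAt_inv (pow_ne_zero 2 hx)).comp_hasFDerivAt x (h1.pow 2))
  have hv := h1.mul ((hu.pow 2).const_sub 1)
  rw [← hasFDerivWithinAt_univ, hasFDerivWithinAt_euclidean]
  intro i
  fin_cases i
  · refine hu.hasFDerivWithinAt.congr_fderiv ?_
    ext v
    simp [planeInverseDeriv, Matrix.mulVec, dotProduct, Fin.sum_univ_two]
    field_simp
    ring
  · refine hv.hasFDerivWithinAt.congr_fderiv ?_
    ext v
    simp [planeInverseDeriv, Matrix.mulVec, dotProduct, Fin.sum_univ_two]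
    field_simp
    ring

theorem boundaryCurve_le_abs_iff (t s : ℝ) :
    boundaryCurve t ≤ |s| ↔ t ^ 2 * (t ^ 2 - 1) ≤ s ^ 2 := by
  unfold boundaryCurve
  rcases le_total |t| 1 with h | h
  · have h2 : t ^ 2 ≤ 1 := (sq_le_one_iff_abs_le_one t).2 h
    rw [max_eq_left h]
    refine iff_of_true (by simp) ?_
    nlinarith [sq_nonneg t, sq_nonneg s]
  · have h2 : 1 ≤ t ^ 2 := (one_le_sq_iff_one_le_abs t).2 h
    rw [max_eq_right h, sq_abs, ← abs_of_nonneg (Real.sqrt_nonneg (t ^ 2 - 1)), ← abs_mul,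
      ← sq_le_sq, mul_pow, Real.sq_sqrt (by linarith)]

/-- The region where the density of the example is positive. -/
def exampleRegion : Set (Euc 2) := {x | boundaryCurve (x 1) ≤ |x 0| ∧ |x 0| < x 1 ^ 2}

theorem apply_one_ne_zero_of_mem {x : Euc 2} (hx : x ∈ exampleRegion) : x 1 ≠ 0 := fun h => by
  have := (abs_nonneg (x 0)).trans_lt hx.2
  rw [h] at this
  simp at this

theorem gap_pos_of_mem {x : Euc 2} (hx : x ∈ exampleRegion) :
    0 < 1 - (x 0 / x 1 ^ 2) ^ 2 := by
  have h1 := apply_one_ne_zero_of_mem hx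
  have h2 : 0 < x 1 ^ 2 := by positivity
  rw [sub_pos, sq_lt_one_iff_abs_lt_one, abs_div, abs_of_pos h2, div_lt_one h2]
  exact hx.2

theorem exampleMap_of_mem {x : Euc 2} (hx : x ∈ exampleRegion) :
    exampleMap x = planeInverse 1 x := by
  have h1 := apply_one_ne_zero_of_mem hx
  rw [exampleMap, if_neg (fun h => h1 h.2), if_neg (fun h => not_lt.2 h.2 hx.2),
    if_pos (show boundaryCurve (x 1) ≤ |x 0| ∧ |x 0| < x 1 ^ 2 from hx)]
  apply euc_two_ext <;> simp only [planeInverse, PiLp.toLp_apply, PiLp.smul_apply, smul_eq_mul,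
    Matrix.cons_val_zero, Matrix.cons_val_one] <;> field_simp

theorem planeInverse_mem_closedBall {x : Euc 2} (hx : x ∈ exampleRegion) :
    planeInverse 1 x ∈ Metric.closedBall (0 : Euc 2) 1 := by
  have h1 := apply_one_ne_zero_of_mem hx
  have hg := gap_pos_of_mem hx
  have hc := (boundaryCurve_le_abs_iff _ _).1 hx.1
  rw [mem_closedBall_euc_two]
  simp only [planeInverse, PiLp.toLp_apply, Matrix.cons_val_zero, Matrix.cons_val_one]
  -- With `u = x₀ / x₁²`, the image has squared norm `u² + x₁² (1 - u²)²`, so this bound puts it in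
  -- the disc; it is exactly the condition given by `boundaryCurve`.
  have h2 : x 1 ^ 2 * (1 - (x 0 / x 1 ^ 2) ^ 2) ≤ 1 := by
    have e : x 1 ^ 2 * (1 - (x 0 / x 1 ^ 2) ^ 2) = (x 1 ^ 4 - x 0 ^ 2) / x 1 ^ 2 := by
      field_simp
    rw [e, div_le_one (by positivity)]
    linarith
  have h3 := mul_le_mul_of_nonneg_right h2 hg.le
  linarith [h3]

theorem image_exampleRegion_ae_eq :
    planeInverse 1 '' exampleRegion =ᵐ[volume] Metric.closedBall (0 : Euc 2) 1 := by
  filter_upwards [measure_eq_zero_iff_ae_notMem.1 volume_setOf_apply_one_eq_zero] with y hy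
  refine propext ⟨?_, fun hyB => ?_⟩
  · rintro ⟨x, hx, rfl⟩
    exact planeInverse_mem_closedBall hx
  · have hy1 : y 1 ≠ 0 := hy
    have hg : 0 < 1 - y 0 ^ 2 :=
      (closedBall_gap le_rfl hyB).1.lt_of_ne fun h => hy1 ((closedBall_gap le_rfl hyB).2 h.symm)
    have hyB := mem_closedBall_euc_two.1 hyB
    refine ⟨planeGradient 1 y, ⟨?_, ?_⟩, planeInverse_planeGradient hy1 hg.ne'⟩
    · rw [boundaryCurve_le_abs_iff]
      simp only [planeGradient, PiLp.toLp_apply, Matrix.cons_val_zero, Matrix.cons_val_one]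
      rw [← sub_nonneg]
      have e : (y 0 * y 1 ^ 2 / (1 - y 0 ^ 2) ^ 2) ^ 2 - (y 1 / (1 - y 0 ^ 2)) ^ 2 *
          ((y 1 / (1 - y 0 ^ 2)) ^ 2 - 1) =
          y 1 ^ 2 * (1 - y 0 ^ 2 - y 1 ^ 2) / (1 - y 0 ^ 2) ^ 3 := by
        field_simp; ring
      rw [e]
      exact div_nonneg (mul_nonneg (sq_nonneg _) (by linarith)) (by positivity)
    · simp only [planeGradient, PiLp.toLp_apply, Matrix.cons_val_zero, Matrix.cons_val_one]
      have e : y 0 * y 1 ^ 2 / (1 - y 0 ^ 2) ^ 2 = y 0 * (y 1 / (1 - y 0 ^ 2)) ^ 2 := by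
        rw [div_pow]; ring
      rw [e, abs_mul, abs_sq]
      have h0 : |y 0| < 1 := (sq_lt_one_iff_abs_lt_one _).1 (by linarith)
      have h2 : y 1 / (1 - y 0 ^ 2) ≠ 0 := div_ne_zero hy1 hg.ne'
      have h3 : 0 < (y 1 / (1 - y 0 ^ 2)) ^ 2 := by positivity
      nlinarith

/-- The branches say where the maximum sits: at `(±1, 0)`, at a point with `∇ψ y = x`, or on the
circle, where `x - ∇ψ y` is an outward normal. -/
theorem isLegendreSelection_exampleMap :
    IsLegendreSelection (Metric.closedBall 0 1) (planePotential 1) exampleMap := by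
  intro x
  by_cases h0 : x 0 = 0 ∧ x 1 = 0
  · rw [exampleMap, if_pos h0]
    refine ⟨by simp, fun y hy => ?_⟩
    have := planePotential_nonneg le_rfl hy
    rw [inner_euc_two, h0.1, h0.2, inner_zero_right, planePotential_zero]
    linarith
  by_cases h1 : x 0 ≠ 0 ∧ x 1 ^ 2 ≤ |x 0|
  · rw [exampleMap, if_neg h0, if_pos h1]
    have ha : 0 < |x 0| := abs_pos.2 h1.1
    have c0 : ((1 / |x 0|) • (!₂[x 0, 0] : Euc 2)) 0 = x 0 / |x 0| := by
      simp [div_eq_inv_mul]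
    have c1 : ((1 / |x 0|) • (!₂[x 0, 0] : Euc 2)) 1 = 0 := by simp
    have hsq : x 0 ^ 2 = |x 0| ^ 2 := (sq_abs _).symm
    refine ⟨?_, fun y hy => ?_⟩
    · rw [mem_closedBall_euc_two, c0, c1, div_pow, hsq, div_self (by positivity)]
      simp
    · have hm := mul_sub_planePotential_le (closedBall_gap le_rfl hy).1
        (closedBall_gap le_rfl hy).2 (x 1)
      have hg := (closedBall_gap le_rfl hy).1
      have hR : inner ℝ x ((1 / |x 0|) • (!₂[x 0, 0] : Euc 2)) -
          planePotential 1 ((1 / |x 0|) • (!₂[x 0, 0] : Euc 2)) = |x 0| := by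
        rw [inner_euc_two, planePotential, c0, c1, mul_div_assoc', ← sq, hsq]
        field_simp
        simp
      rw [hR, inner_euc_two]
      have h2 : x 0 * y 0 ≤ |x 0| * |y 0| := by rw [← abs_mul]; exact le_abs_self _
      have h3 : (1 - y 0 ^ 2) * x 1 ^ 2 ≤ (1 - y 0 ^ 2) * |x 0| := by gcongr; exact h1.2
      have h4 : y 0 ^ 2 = |y 0| ^ 2 := (sq_abs _).symm
      rw [h4] at h3 hm
      -- The bound in `|y 0|` falls short of `|x 0|` by `|x 0| (1 - |y 0|)² / 2`.
      nlinarith [mul_nonneg ha.le (sq_nonneg (1 - |y 0|))]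
  by_cases h2 : x ∈ exampleRegion
  · rw [exampleMap_of_mem h2]
    refine ⟨planeInverse_mem_closedBall h2, fun y hy => ?_⟩
    have hg := gap_pos_of_mem h2
    have h3 := planePotential_add_inner_le le_rfl
      (y := planeInverse 1 x) (by simpa [planeInverse] using sub_pos.1 hg) hy
    rw [planeGradient_planeInverse (apply_one_ne_zero_of_mem h2) hg.ne', inner_sub_left,
      real_inner_comm, real_inner_comm x (planeInverse 1 x)] at h3
    linarith
  · have h2' : ¬ (boundaryCurve (x 1) ≤ |x 0| ∧ |x 0| < x 1 ^ 2) := h2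
    rw [exampleMap, if_neg h0, if_neg h1, if_neg h2']
    have h3 : |x 0| < x 1 ^ 2 := by
      by_cases hx0 : x 0 = 0
      · have : x 1 ≠ 0 := fun h => h0 ⟨hx0, h⟩
        rw [hx0, abs_zero]; positivity
      · exact not_le.1 fun h => h1 ⟨hx0, h⟩
    have h4 : x 0 ^ 2 < x 1 ^ 2 * (x 1 ^ 2 - 1) :=
      not_le.1 fun h => h2' ⟨(boundaryCurve_le_abs_iff _ _).2 h, h3⟩
    have hx1 : x 1 ≠ 0 := fun h => by
      rw [h] at h3
      simp only [ne_eq, OfNat.ofNat_ne_zero, not_false_eq_true, zero_pow] at h3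
      exact absurd h3 (not_lt.2 (abs_nonneg _))
    have hr : 0 < ‖x‖ := norm_pos_iff.2 fun h => hx1 (by rw [h]; rfl)
    set r := ‖x‖ with hrdef
    have hr2 : r ^ 2 = x 0 ^ 2 + x 1 ^ 2 := norm_sq_euc_two x
    set y : Euc 2 := (1 / r) • x with hy
    have hxy : x = r • y := by rw [hy, smul_smul, mul_one_div_cancel hr.ne', one_smul]
    have hyn : ‖y‖ = 1 := by
      rw [hy, norm_smul, Real.norm_of_nonneg (by positivity), ← hrdef, one_div_mul_cancel hr.ne']
    have hys : y 0 ^ 2 + y 1 ^ 2 = 1 := by rw [← norm_sq_euc_two, hyn, one_pow]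
    have hy1 : y 1 = x 1 / r := by simp [hy, div_eq_inv_mul]
    have hy1' : y 1 ≠ 0 := by rw [hy1]; positivity
    have hgap : 1 - y 0 ^ 2 = y 1 ^ 2 := by linarith
    have hgrad : planeGradient 1 y = (1 / y 1 ^ 2) • y := by
      apply euc_two_ext <;> simp only [planeGradient, PiLp.toLp_apply, Matrix.cons_val_zero,
        Matrix.cons_val_one, hgap, PiLp.smul_apply, smul_eq_mul] <;> field_simp
    refine ⟨by simp [hyn], fun z hz => ?_⟩
    have hpos : 0 < y 1 ^ 2 := by positivity
    have h5 := planePotential_add_inner_le le_rfl (y := y) (by linarith) hz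
    rw [hgrad, inner_smul_right, inner_sub_left, real_inner_self_eq_norm_sq, hyn] at h5
    have h6 : inner ℝ z y ≤ 1 := by
      refine (real_inner_le_norm z y).trans ?_
      rw [hyn, mul_one]; simpa using hz
    -- On the circle `∇ψ y = y / y₁²`, so `x - ∇ψ y = (r - 1 / y₁²) y` points outward as soon as `r
    -- ≤ x₁²`, which is what `h4` gives.
    have h7 : 1 / y 1 ^ 2 ≤ r := by
      rw [hy1, div_pow, one_div_div, div_le_iff₀ (by positivity), sq]
      refine mul_le_mul_of_nonneg_left ?_ hr.le
      exact (sq_le_sq₀ hr.le (sq_nonneg _)).1 (by rw [hr2]; linarith)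
    have e1 : inner ℝ x z = r * inner ℝ z y := by
      rw [hxy, real_inner_smul_left, real_inner_comm]
    have e2 : inner ℝ x y = r := by
      conv_lhs => rw [hxy]
      rw [real_inner_smul_left, real_inner_self_eq_norm_sq, hyn]; ring
    rw [e1, e2]
    nlinarith [mul_nonneg (sub_nonneg.2 h7) (sub_nonneg.2 h6)]

end Example

/-! ### Change of variables and discontinuity at the origin -/

section ExampleMeasure

theorem measurableSet_exampleRegion : MeasurableSet exampleRegion := by
  have hc : Continuous boundaryCurve := by
    unfold boundaryCurve
    fun_prop
  exact (measurableSet_le (f := fun x : Euc 2 => boundaryCurve (x 1)) (by fun_prop)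
    (by fun_prop)).inter (measurableSet_lt (f := fun x : Euc 2 => |x 0|) (by fun_prop)
    (by fun_prop))

/-- This form feeds the change of variables formula for `planeInverse 1`. -/
theorem exampleMeasure_eq : exampleMeasure = ENNReal.ofReal (1 / Real.pi) •
    (volume.restrict exampleRegion).withDensity
      (fun x => ENNReal.ofReal |(planeInverseDeriv x).det|) := by
  rw [← withDensity_smul' _ _ ENNReal.ofReal_ne_top,
    ← withDensity_indicator measurableSet_exampleRegion, exampleMeasure]
  congr 1
  ext x
  by_cases hx : x ∈ exampleRegion
  · have h1 := apply_one_ne_zero_of_mem hx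
    have h2 : 0 ≤ (x 1 ^ 4 - x 0 ^ 2) / x 1 ^ 6 := by
      have e : (x 1 ^ 4 - x 0 ^ 2) / x 1 ^ 6 = (1 - (x 0 / x 1 ^ 2) ^ 2) / x 1 ^ 2 := by
        field_simp
      rw [e]
      exact div_nonneg (gap_pos_of_mem hx).le (sq_nonneg _)
    rw [indicator_of_mem hx, Pi.smul_apply, smul_eq_mul, det_planeInverseDeriv h1,
      abs_of_nonneg h2, ← ENNReal.ofReal_mul (by positivity), exampleDensity]
    rw [if_pos (show boundaryCurve (x 1) ≤ |x 0| ∧ |x 0| < x 1 ^ 2 from hx)]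
  · rw [indicator_of_notMem hx, exampleDensity]
    rw [if_neg (show ¬ (boundaryCurve (x 1) ≤ |x 0| ∧ |x 0| < x 1 ^ 2) from hx)]
    simp

theorem injOn_planeInverse : InjOn (planeInverse 1) exampleRegion := by
  refine LeftInvOn.injOn (f₁' := planeGradient 1) fun x hx => ?_
  exact planeGradient_planeInverse (apply_one_ne_zero_of_mem hx) (gap_pos_of_mem hx).ne'

theorem map_planeInverse_exampleMeasure :
    exampleMeasure.map (planeInverse 1) = uniformUnitBall 2 := by
  rw [exampleMeasure_eq, Measure.map_smul, map_withDensity_abs_det_fderiv_eq_addHaar volume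
    measurableSet_exampleRegion.nullMeasurableSet
    (fun x hx => (hasFDerivAt_planeInverse (apply_one_ne_zero_of_mem hx)).hasFDerivWithinAt)
    injOn_planeInverse, Measure.restrict_congr_set image_exampleRegion_ae_eq, uniformUnitBall,
    ProbabilityTheory.cond, EuclideanSpace.volume_closedBall_fin_two]
  congr 1
  rw [ENNReal.ofReal_one, one_pow, one_mul, one_div, ENNReal.ofReal_inv_of_pos Real.pi_pos]

theorem ae_mem_exampleRegion : ∀ᵐ x ∂exampleMeasure, x ∈ exampleRegion := by
  rw [exampleMeasure_eq]
  refine Measure.ae_smul_measure ?_ _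
  exact (withDensity_absolutelyContinuous _ _).ae_le (ae_restrict_mem measurableSet_exampleRegion)

theorem exampleMeasure_absolutelyContinuous : exampleMeasure ≪ volume :=
  withDensity_absolutelyContinuous _ _

theorem map_exampleMap_exampleMeasure :
    exampleMeasure.map exampleMap = uniformUnitBall 2 := by
  rw [← map_planeInverse_exampleMeasure]
  refine Measure.map_congr ?_
  filter_upwards [ae_mem_exampleRegion] with x hx using exampleMap_of_mem hx

theorem map_planeGradient_uniformUnitBall :
    (uniformUnitBall 2).map (planeGradient 1) = exampleMeasure := by
  rw [← map_planeInverse_exampleMeasure, Measure.map_map (measurable_planeGradient 1)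
    (measurable_planeInverse 1)]
  conv_rhs => rw [← Measure.map_id (μ := exampleMeasure)]
  refine Measure.map_congr ?_
  filter_upwards [ae_mem_exampleRegion] with x hx using
    planeGradient_planeInverse (apply_one_ne_zero_of_mem hx) (gap_pos_of_mem hx).ne'

/-- At `x = 0` the maximizers are the zeros of the nonnegative `ψ`, hence the whole horizontal
diameter. -/
theorem isLegendreSelection_update_exampleMap {v : Euc 2}
    (hv : v ∈ segment ℝ (!₂[1, 0] : Euc 2) (-!₂[1, 0])) :
    IsLegendreSelection (Metric.closedBall 0 1) (planePotential 1)
      (Function.update exampleMap 0 v) := by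
  obtain ⟨a, b, ha, hb, hab, rfl⟩ := hv
  refine isLegendreSelection_exampleMap.update ?_ fun y hy => ?_
  · refine (convex_closedBall (0 : Euc 2) 1) ?_ ?_ ha hb hab <;> rw [mem_closedBall_euc_two] <;>
      simp
  · have := planePotential_nonneg le_rfl hy
    simpa [planePotential] using this

theorem exampleMap_of_sq_lt {ε : ℝ} (hε : |ε| = 1) {x : Euc 2} (hx : x 1 ^ 2 < ε * x 0) :
    exampleMap x = !₂[ε, 0] := by
  have hpos : 0 < ε * x 0 := (sq_nonneg _).trans_lt hx
  have h0 : x 0 ≠ 0 := right_ne_zero_of_mul hpos.ne'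
  have habs : |x 0| = ε * x 0 := by rw [← abs_of_pos hpos, abs_mul, hε, one_mul]
  have hε2 : ε * ε = 1 := by rw [← sq, ← sq_abs, hε, one_pow]
  rw [exampleMap, if_neg (fun h => h0 h.1), if_pos ⟨h0, habs ▸ hx.le⟩, habs]
  have hε0 : ε ≠ 0 := left_ne_zero_of_mul hpos.ne'
  apply euc_two_ext
  · simp only [PiLp.smul_apply, Matrix.cons_val_zero, smul_eq_mul]
    field_simp
    linarith
  · simp

/-- A version agrees with the map on a dense set, and the open set where the map equals `(ε, 0)` has
`0` in its closure. -/
theorem apply_zero_eq_of_continuousAt {G : Euc 2 → Euc 2} (hG : G =ᵐ[volume] exampleMap)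
    (hc : ContinuousAt G 0) {ε : ℝ} (hε : |ε| = 1) : G 0 = !₂[ε, 0] := by
  have hε2 : ε * ε = 1 := by rw [← sq, ← sq_abs, hε, one_pow]
  have hU : IsOpen {x : Euc 2 | x 1 ^ 2 < ε * x 0} :=
    isOpen_lt (by fun_prop) (by fun_prop)
  have hd : Dense {x : Euc 2 | G x = exampleMap x} := Measure.dense_of_ae hG
  have h0 : (0 : Euc 2) ∈ closure {x : Euc 2 | x 1 ^ 2 < ε * x 0} := by
    have h1 : ContinuousWithinAt (fun t : ℝ => t • (!₂[ε, 0] : Euc 2)) (Ioi 0) 0 :=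
      Continuous.continuousWithinAt (by fun_prop)
    have h2 := h1.mem_closure_image (by rw [closure_Ioi]; exact self_mem_Ici)
    rw [zero_smul] at h2
    refine closure_mono ?_ h2
    rintro _ ⟨t, ht, rfl⟩
    have ht : 0 < t := ht
    have : ε * (t * ε) = t := by rw [mul_left_comm, hε2, mul_one]
    simpa [this] using ht
  have h3 := closure_minimal (hd.open_subset_closure_inter hU) isClosed_closure h0
  have h4 := hc.continuousWithinAt.mem_closure_image h3
  have h5 : G '' ({x : Euc 2 | x 1 ^ 2 < ε * x 0} ∩ {x : Euc 2 | G x = exampleMap x})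
      ⊆ {!₂[ε, 0]} := by
    rintro _ ⟨x, ⟨hx1, hx2⟩, rfl⟩
    have hx2 : G x = exampleMap x := hx2
    rw [mem_singleton_iff, hx2, exampleMap_of_sq_lt hε hx1]
  exact closure_minimal h5 isClosed_singleton h4

theorem not_continuousAt_of_ae_eq_exampleMap {G : Euc 2 → Euc 2}
    (hG : G =ᵐ[volume] exampleMap) : ¬ ContinuousAt G 0 := by
  intro hc
  have h1 := apply_zero_eq_of_continuousAt hG hc (ε := 1) (by simp)
  have h2 := apply_zero_eq_of_continuousAt hG hc (ε := -1) (by simp)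
  have h3 := congrArg (fun v : Euc 2 => v 0) (h1.symm.trans h2)
  norm_num at h3

end ExampleMeasure

/-! ### A discontinuous example with finite second moment -/

section FiniteSecondMoment

/-- Up to the null diameter and circle, the preimage of a null set lies in its image under the
differentiable inverse, which is null. -/
theorem map_planeGradient_absolutelyContinuous {a : ℝ} (ha : 1 ≤ a) :
    (uniformUnitBall 2).map (planeGradient a) ≪ volume := by
  refine Measure.AbsolutelyContinuous.mk fun A hA hA0 => ?_
  rw [Measure.map_apply (measurable_planeGradient a) hA]
  have hsub : planeGradient a ⁻¹' A ∩ slitDisc ⊆ planeInverse a '' (A ∩ {x | x 1 ≠ 0}) := by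
    rintro y ⟨hyA, hy⟩
    have hg := sub_pos.2 (slitDisc_subset_planeDomain ha hy).2
    refine ⟨planeGradient a y, ⟨hyA, ?_⟩, planeInverse_planeGradient hy.2 hg.ne'⟩
    exact div_ne_zero hy.2 hg.ne'
  have hdiff : DifferentiableOn ℝ (planeInverse a) (A ∩ {x | x 1 ≠ 0}) := by
    rw [differentiableOn_euclidean]
    have h1 : ∀ x ∈ A ∩ {x : Euc 2 | x 1 ≠ 0}, x 1 ^ 2 ≠ 0 := fun x hx => pow_ne_zero 2 hx.2
    have hu : DifferentiableOn ℝ (fun x : Euc 2 => x 0 / x 1 ^ 2) (A ∩ {x | x 1 ≠ 0}) :=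
      DifferentiableOn.fun_mul (by fun_prop) (DifferentiableOn.fun_inv (by fun_prop) h1)
    intro i
    fin_cases i
    · exact hu
    · exact DifferentiableOn.mul (by fun_prop) ((hu.pow 2).const_sub a)
  have h0 : volume (planeGradient a ⁻¹' A ∩ slitDisc) = 0 := measure_mono_null hsub
    (addHaar_image_eq_zero_of_differentiableOn_of_addHaar_eq_zero volume hdiff
      (measure_mono_null inter_subset_left hA0))
  have h1 := uniformUnitBall_absolutelyContinuous 2 h0
  rw [← h1]
  refine measure_congr ?_
  filter_upwards [ae_mem_slitDisc] with y hy
  exact propext ⟨fun h => ⟨h, hy⟩, fun h => h.1⟩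

theorem integrable_norm_sq_map_planeGradient {a : ℝ} (ha : 2 ≤ a) :
    Integrable (fun x => ‖x‖ ^ 2) ((uniformUnitBall 2).map (planeGradient a)) := by
  rw [integrable_map_measure (by fun_prop) (measurable_planeGradient a).aemeasurable]
  refine Integrable.of_bound (C := 2) ?_ ?_
  · exact (((measurable_planeGradient a).norm).pow_const 2).aestronglyMeasurable
  · filter_upwards [ae_mem_slitDisc] with y hy
    have hB := mem_closedBall_euc_two.1 (Metric.ball_subset_closedBall hy.1)
    have h0 : y 0 ^ 2 ≤ 1 := by linarith [sq_nonneg (y 1)]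
    have h1 : y 1 ^ 2 ≤ 1 := by linarith [sq_nonneg (y 0)]
    -- The choice `a ≥ 2` keeps the denominators at least `1` on the disc, so both coordinates of
    -- the gradient are bounded by `1`.
    have hs : 1 ≤ a - y 0 ^ 2 := by linarith
    have hb : (y 1 / (a - y 0 ^ 2)) ^ 2 ≤ 1 := by
      rw [div_pow]
      exact div_le_one_of_le₀ (h1.trans (one_le_pow₀ hs)) (by positivity)
    rw [Function.comp_apply, Real.norm_of_nonneg (by positivity), norm_sq_euc_two]
    simp only [planeGradient, PiLp.toLp_apply, Matrix.cons_val_zero, Matrix.cons_val_one]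
    have e : (y 0 * y 1 ^ 2 / (a - y 0 ^ 2) ^ 2) ^ 2 =
        y 0 ^ 2 * ((y 1 / (a - y 0 ^ 2)) ^ 2) ^ 2 := by
      rw [div_pow (y 1)]; ring
    rw [e]
    have h3 : ((y 1 / (a - y 0 ^ 2)) ^ 2) ^ 2 ≤ 1 := pow_le_one₀ (sq_nonneg _) hb
    have h4 : y 0 ^ 2 * ((y 1 / (a - y 0 ^ 2)) ^ 2) ^ 2 ≤ 1 := mul_le_one₀ h0 (sq_nonneg _) h3
    linarith

theorem exists_isLegendreSelection_planePotential {a : ℝ} (ha : 1 < a) :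
    ∃ F, IsLegendreSelection (Metric.closedBall 0 1) (planePotential a) F := by
  have hc : ContinuousOn (planePotential a) (Metric.closedBall 0 1) := by
    refine ContinuousOn.div (by fun_prop) (by fun_prop) fun y hy => ?_
    have := mem_closedBall_euc_two.1 hy
    have : 0 < a - y 0 ^ 2 := by linarith [sq_nonneg (y 1)]
    positivity
  have h : ∀ x : Euc 2, ∃ z ∈ Metric.closedBall (0 : Euc 2) 1, ∀ y ∈ Metric.closedBall (0 : Euc 2) 1,
      inner ℝ x y - planePotential a y ≤ inner ℝ x z - planePotential a z := fun x =>
    (isCompact_closedBall (0 : Euc 2) 1).exists_isMaxOn ⟨0, by simp⟩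
      (ContinuousOn.sub (by fun_prop) hc)
  choose F hF using h
  exact ⟨F, hF⟩

/-- On the horizontal axis, the first coordinate of a maximizer is the sign of that of the argument. -/
theorem mul_apply_zero_eq_one {a : ℝ} (ha : 1 ≤ a) {F : Euc 2 → Euc 2}
    (hF : IsLegendreSelection (Metric.closedBall 0 1) (planePotential a) F) {ε t : ℝ}
    (hε : |ε| = 1) (ht : 0 < t) : ε * F (t • !₂[ε, 0]) 0 = 1 := by
  have hε2 : ε * ε = 1 := by rw [← sq, ← sq_abs, hε, one_pow]
  obtain ⟨hz, hmax⟩ := hF (t • !₂[ε, 0])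
  set z := F (t • !₂[ε, 0])
  have h1 := hmax !₂[ε, 0] (by rw [mem_closedBall_euc_two]; simp [sq, hε2])
  have h2 := planePotential_nonneg ha hz
  rw [real_inner_smul_left, real_inner_smul_left, inner_euc_two, inner_euc_two] at h1
  simp only [planePotential, Matrix.cons_val_zero, Matrix.cons_val_one] at h1 h2
  have h3 : t * 1 ≤ t * (ε * z 0) := by
    rw [hε2] at h1
    simp only [mul_zero, zero_mul, add_zero, ne_eq, OfNat.ofNat_ne_zero, not_false_eq_true,
      zero_pow, zero_div, sub_zero, mul_one] at h1 ⊢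
    linarith
  refine le_antisymm ?_ (le_of_mul_le_mul_left h3 ht)
  have h4 : |z 0| ≤ 1 := by
    have := mem_closedBall_euc_two.1 hz
    exact (sq_le_one_iff_abs_le_one _).1 (by linarith [sq_nonneg (z 1)])
  calc ε * z 0 ≤ |ε * z 0| := le_abs_self _
    _ ≤ 1 := by rw [abs_mul, hε, one_mul]; exact h4

theorem not_continuous_of_isLegendreSelection {a : ℝ} (ha : 1 ≤ a) {F : Euc 2 → Euc 2}
    (hF : IsLegendreSelection (Metric.closedBall 0 1) (planePotential a) F) :
    ¬ Continuous F := by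
  intro hc
  -- Letting `t` decrease to `0` along both half-axes would give `F 0` first coordinate `1` and `-1`
  -- at once.
  have key : ∀ ε : ℝ, |ε| = 1 → ε * F 0 0 = 1 := by
    intro ε hε
    have hcont : Continuous fun t : ℝ => ε * F (t • !₂[ε, 0]) 0 := by fun_prop
    have hcl : IsClosed {t : ℝ | ε * F (t • !₂[ε, 0]) 0 = 1} :=
      isClosed_eq hcont continuous_const
    have h0 : (0 : ℝ) ∈ closure (Ioi (0 : ℝ)) := by rw [closure_Ioi]; exact self_mem_Ici
    have h : ε * F ((0 : ℝ) • !₂[ε, 0]) 0 = 1 :=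
      closure_minimal (fun t ht => mul_apply_zero_eq_one ha hF hε ht) hcl h0
    rwa [zero_smul] at h
  have h1 := key 1 (by simp)
  have h2 := key (-1) (by simp)
  linarith

end FiniteSecondMoment

end

theorem mainTheorem7 :
    -- `μ` is an absolutely continuous probability measure, `F` maps into the unit disc
    IsProbabilityMeasure exampleMeasure ∧ exampleMeasure ≪ volume ∧
    (∀ x, exampleMap x ∈ Metric.closedBall (0 : Euc 2) 1) ∧
    -- `F` is cyclically monotone, pushes `μ` to the uniform distribution, and is a BDF of `μ`
    CyclicallyMonotoneOn exampleMap univ ∧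
    AEMeasurable exampleMap exampleMeasure ∧
    exampleMeasure.map exampleMap = uniformUnitBall 2 ∧
    IsBDF exampleMeasure (uniformUnitBall 2) exampleMap ∧
    -- so is every map that differs from `F` at `0` only, by a value between `(1,0)` and `-(1,0)`
    (∀ v ∈ segment ℝ (!₂[1, 0] : Euc 2) (-!₂[1, 0]),
      IsBDF exampleMeasure (uniformUnitBall 2) (Function.update exampleMap 0 v)) ∧
    -- no version of `F` is continuous at `0`
    (∀ G : Euc 2 → Euc 2, G =ᵐ[volume] exampleMap → ¬ ContinuousAt G 0) ∧
    -- BDFs need not be continuous even if the second moment is finite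
    (∃ (μ : Measure (Euc 2)) (F : Euc 2 → Euc 2),
      Integrable (fun x => ‖x‖ ^ 2) μ ∧ IsBDF μ (uniformUnitBall 2) F ∧ ¬ Continuous F) := by
  have hBDF := isBDF_planeGradient le_rfl map_planeGradient_uniformUnitBall
    exampleMeasure_absolutelyContinuous isLegendreSelection_exampleMap
  refine ⟨hBDF.isProbabilityMeasure_left, exampleMeasure_absolutelyContinuous,
    fun x => (isLegendreSelection_exampleMap x).1,
    isLegendreSelection_exampleMap.cyclicallyMonotoneOn _,
    (isLegendreSelection_exampleMap.aemeasurable subset_rfl).mono_ac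
      exampleMeasure_absolutelyContinuous,
    map_exampleMap_exampleMeasure, hBDF, fun v hv => ?_,
    fun G hG => not_continuousAt_of_ae_eq_exampleMap hG, ?_⟩
  · exact isBDF_planeGradient le_rfl map_planeGradient_uniformUnitBall
      exampleMeasure_absolutelyContinuous (isLegendreSelection_update_exampleMap hv)
  · obtain ⟨F, hF⟩ := exists_isLegendreSelection_planePotential one_lt_two
    exact ⟨(uniformUnitBall 2).map (planeGradient 2), F,
      integrable_norm_sq_map_planeGradient le_rfl,
      isBDF_planeGradient one_le_two rfl (map_planeGradient_absolutelyContinuous one_le_two) hF,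
      not_continuous_of_isLegendreSelection one_le_two hF⟩
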